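/- Let $T$ be the binary rooted tree, with vertices the finite words over $\{0,1\}$, each word being joined to its two extensions by one letter at the end. For $n\ge 0$ let $\sigma_n$ be the automorphism of $T$ that interchanges the two branches below the vertex $w_n$, where $w_0=\emptyset$ and $w_n=1^{n-1}0$ for $n\ge 1$; that is, $\sigma_n(w_n x v)=w_n(1-x)v$ for every letter $x$ and word $v$, and all other vertices are fixed. For $\omega=\omega_1\omega_2\ldots\in\{0,1,2\}^{\mathbb N}$ put $$a=\sigma_0,\qquad b_\omega=\prod_{n\ge1:\ \omega_n\in\{0,1\}}\sigma_n,\qquad c_\omega=\prod_{n\ge1:\ \omega_n\in\{0,2\}}\sigma_n,\qquad d_\omega=\prod_{n\ge1:\ \omega_n\in\{1,2\}}\sigma_n,$$ and let $G_\omega$ be the group of automorphisms of $T$ generated by $a,b_\omega,c_\omega,d_\omega$. Let $\Omega_2$ be the set of those $\omega$ in which at least two of the symbols $0,1,2$ occur infinitely often. For a group $G$ with a finite symmetric generating set $S$, let $\mathrm{sp}(G)$ denote the spectrum of the Markov operator $(Mf)(g)=\frac1{|S|}\sum_{s\in S}f(s^{-1}g)$ on $\ell^2(G)$. **Theorem.**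 Let $G$ be an amenable group generated by four involutions $\tilde a,\tilde b,\tilde c,\tilde d$ (elements of order $2$) such that $\tilde b\tilde c\tilde d=1$. Assume that for some $\omega\in\Omega_2$ there is a surjective homomorphism $\varphi:G\to G_\omega$ with $\varphi(\tilde a)=a$, $\varphi(\tilde b)=b_\omega$, $\varphi(\tilde c)=c_\omega$, $\varphi(\tilde d)=d_\omega$. Then, with respect to $S=\{\tilde a,\tilde b,\tilde c,\tilde d\}$, $$\mathrm{sp}(G)=\left[-\tfrac12,0\right]\cup\left[\tfrac12,1\right].$$ -/

import Mathlib

/-! ### Amenability -/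

open Classical in
/-- A (discrete) group is amenable if it satisfies Følner's condition: for every finite `K ⊆ G` and
every `ε > 0` there is a finite non-empty `F ⊆ G` with `|gF \ F| ≤ ε |F|` for all `g ∈ K`. -/
def IsAmenableGroup (G : Type*) [Group G] : Prop :=
  ∀ (K : Finset G) (ε : ℝ), 0 < ε → ∃ F : Finset G, F.Nonempty ∧
    ∀ g ∈ K, (((F.image fun x => g * x) \ F).card : ℝ) ≤ ε * (F.card : ℝ)

/-! ### The Markov operator of a Cayley graph and the spectrum of a group -/

section Markov

variable {G : Type*} [Group G]

theorem memlp_two_translate (s : G) {f : G → ℂ} (hf : Memℓp f 2) :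
    Memℓp (fun g => f (s⁻¹ * g)) 2 := by
  have h2 : 0 < (2 : ENNReal).toReal := by norm_num
  rw [memℓp_gen_iff h2] at hf ⊢
  exact hf.comp_injective (mul_right_injective s⁻¹)

/-- The left regular representation: `(leftRegular s f) g = f (s⁻¹ g)` on `ℓ²(G)`. -/
noncomputable def leftRegular (s : G) :
    lp (fun _ : G => ℂ) 2 →ₗᵢ[ℂ] lp (fun _ : G => ℂ) 2 where
  toFun f := ⟨fun g => f (s⁻¹ * g), memlp_two_translate s (lp.memℓp f)⟩
  map_add' _ _ := rfl
  map_smul' _ _ := rfl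
  norm_map' f := by
    have h2 : 0 < (2 : ENNReal).toReal := by norm_num
    rw [lp.norm_eq_tsum_rpow h2, lp.norm_eq_tsum_rpow h2]
    congr 1
    exact (Equiv.mulLeft s⁻¹).tsum_eq (fun g => ‖f g‖ ^ (2 : ENNReal).toReal)

/-- The Markov operator of the Cayley graph of `G` with respect to the finite set `S`. -/
noncomputable def markovOperator (S : Finset G) :
    lp (fun _ : G => ℂ) 2 →L[ℂ] lp (fun _ : G => ℂ) 2 :=
  (S.card : ℂ)⁻¹ • ∑ s ∈ S, (leftRegular s).toContinuousLinearMap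

theorem markovOperator_apply (S : Finset G) (f : lp (fun _ : G => ℂ) 2) (g : G) :
    (markovOperator S f : G → ℂ) g = (S.card : ℂ)⁻¹ * ∑ s ∈ S, f (s⁻¹ * g) := by
  simp only [markovOperator, ContinuousLinearMap.smul_apply, ContinuousLinearMap.sum_apply,
    lp.coeFn_smul, lp.coeFn_sum, Pi.smul_apply, smul_eq_mul]
  exact congrArg _ (Finset.sum_apply g S _)

/-- The spectrum `sp(G)` of `G` with respect to the finite generating set `S`: the spectrum of the
Markov operator as a bounded operator on the complex Hilbert space `ℓ²(G)`. -/
noncomputable def groupSpectrum (S : Finset G) : Set ℂ :=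
  spectrum ℂ (markovOperator S)

end Markov

/-! ### The binary rooted tree and the groups `G_ω` -/

/-- The binary rooted tree: vertices are finite words over `{0, 1}` (`false` is `0`, `true` is `1`,
the head of the list is the first letter), and a word is joined to its one-letter extensions. -/
def binaryTree : SimpleGraph (List Bool) where
  Adj u v := (∃ x, v = u ++ [x]) ∨ (∃ x, u = v ++ [x])
  symm := ⟨fun _ _ h => h.symm⟩
  loopless := ⟨fun u h => by simp at h⟩

/-- An involution of the vertex set preserving the parent relation is a tree automorphism. -/
def treeAutOfInvolution (f : List Bool → List Bool) (hf : Function.Involutive f)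
    (h : ∀ u x, ∃ y, f (u ++ [x]) = f u ++ [y]) : binaryTree ≃g binaryTree where
  toEquiv := hf.toPerm f
  map_rel_iff' := by
    have key : ∀ u v, binaryTree.Adj u v → binaryTree.Adj (f u) (f v) := by
      rintro u v (⟨x, rfl⟩ | ⟨x, rfl⟩)
      · exact Or.inl (h u x)
      · exact Or.inr (h v x)
    intro u v
    refine ⟨fun hh => ?_, key u v⟩
    have := key _ _ hh
    simpa [hf u, hf v] using this

/-- `σ₀`: interchange the two branches at the root, i.e. change the first letter. -/
def flipFirst : List Bool → List Bool
  | [] => []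
  | x :: v => (!x) :: v

theorem flipFirst_involutive : Function.Involutive flipFirst := by
  rintro (_ | ⟨x, v⟩) <;> simp [flipFirst]

theorem flipFirst_append (u : List Bool) (x : Bool) :
    ∃ y, flipFirst (u ++ [x]) = flipFirst u ++ [y] := by
  rcases u with _ | ⟨z, v⟩
  · exact ⟨!x, rfl⟩
  · exact ⟨x, rfl⟩

/-- The product, over all `n` with `I n = true`, of the commuting transpositions that interchange
the two branches at the vertex `1ⁿ0`. Explicitly `1ⁿ0xv ↦ 1ⁿ0(1-x)v` if `I n = true`, and all other
words are fixed, see `spinalMap_vertex` and the two lemmas after it. -/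
def spinalMap : (ℕ → Bool) → List Bool → List Bool
  | _, [] => []
  | I, true :: v => true :: spinalMap (fun n => I (n + 1)) v
  | I, false :: v => false :: (if I 0 then flipFirst v else v)

theorem spinalMap_vertex (I : ℕ → Bool) (n : ℕ) (x : Bool) (v : List Bool) :
    spinalMap I (List.replicate n true ++ false :: x :: v) =
      List.replicate n true ++ false :: (if I n then !x else x) :: v := by
  induction n generalizing I with
  | zero => cases h : I 0 <;> simp [spinalMap, flipFirst, h]
  | succ n ih => simp [List.replicate_succ, spinalMap, ih]

theorem spinalMap_ones (I : ℕ → Bool) (n : ℕ) :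
    spinalMap I (List.replicate n true) = List.replicate n true := by
  induction n generalizing I with
  | zero => rfl
  | succ n ih => simp [List.replicate_succ, spinalMap, ih]

theorem spinalMap_ones_zero (I : ℕ → Bool) (n : ℕ) :
    spinalMap I (List.replicate n true ++ [false]) = List.replicate n true ++ [false] := by
  induction n generalizing I with
  | zero => simp [spinalMap, flipFirst]
  | succ n ih => simp [List.replicate_succ, spinalMap, ih]

theorem spinalMap_involutive (I : ℕ → Bool) : Function.Involutive (spinalMap I) := by
  intro u
  induction u generalizing I with
  | nil => rfl
  | cons z v ih =>
    cases z
    · cases h : I 0 <;> simp [spinalMap, h, flipFirst_involutive v]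
    · simp [spinalMap, ih]

theorem spinalMap_append (I : ℕ → Bool) (u : List Bool) (x : Bool) :
    ∃ y, spinalMap I (u ++ [x]) = spinalMap I u ++ [y] := by
  induction u generalizing I with
  | nil => cases x <;> simp [spinalMap, flipFirst]
  | cons z v ih =>
    cases z
    · cases h : I 0
      · exact ⟨x, by simp [spinalMap, h]⟩
      · simpa [spinalMap, h] using flipFirst_append v x
    · simpa [spinalMap] using ih (fun n => I (n + 1))

/-- The generator `a = σ₀`. -/
def genA : binaryTree ≃g binaryTree :=
  treeAutOfInvolution flipFirst flipFirst_involutive flipFirst_append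

/-- The automorphism of the tree given by `spinalMap I`. -/
def spinalAut (I : ℕ → Bool) : binaryTree ≃g binaryTree :=
  treeAutOfInvolution (spinalMap I) (spinalMap_involutive I) (spinalMap_append I)

/-- The generator `b_ω`; the letter `ω n` (`n = 0, 1, …`) governs the action below `1ⁿ0`, and `b_ω`
acts nontrivially there iff `ω n ∈ {0, 1}`. -/
def genB (ω : ℕ → Fin 3) : binaryTree ≃g binaryTree := spinalAut fun n => decide (ω n ≠ 2)

/-- The generator `c_ω`: nontrivial below `1ⁿ0` iff `ω n ∈ {0, 2}`. -/
def genC (ω : ℕ → Fin 3) : binaryTree ≃g binaryTree := spinalAut fun n => decide (ω n ≠ 1)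

/-- The generator `d_ω`: nontrivial below `1ⁿ0` iff `ω n ∈ {1, 2}`. -/
def genD (ω : ℕ → Fin 3) : binaryTree ≃g binaryTree := spinalAut fun n => decide (ω n ≠ 0)

/-- The group `G_ω`, generated by `a, b_ω, c_ω, d_ω` in the automorphism group of the tree. -/
def grigorchukGroup (ω : ℕ → Fin 3) : Subgroup (binaryTree ≃g binaryTree) :=
  Subgroup.closure {genA, genB ω, genC ω, genD ω}

/-- `Ω₂`: the sequences in which at least two of the symbols `0, 1, 2` occur infinitely often. -/
def Omega2 : Set (ℕ → Fin 3) :=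
  {ω | ∃ i j : Fin 3, i ≠ j ∧ {n | ω n = i}.Infinite ∧ {n | ω n = j}.Infinite}

/-! Upper bound: in the regular representation `1, b, c, d` form a Klein four-group, so `q = (b + c
+ d - 1) / 2` is a self-adjoint involution and `4M - 1 = a + 2q`. Hence `(4M - 1)² = 5 + 2(aq + qa)`
with `‖2(aq + qa)‖ ≤ 4`, which forces `1 ≤ |4x - 1| ≤ 3` on the spectrum (`spectrum_mean_subset`).

Lower bound: by amenability, every eigenvalue of the averaged action on a finite `G`-set lies in the
spectrum (`mem_groupSpectrum_of_eigenfunction`). On words of length `n`, `b + c + d` acts as `2s +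
1`, where `s` is the full spinal swap, whatever `ω` is (`sum_spinal`). Thus only the dihedral action
of `a` and `s` matters. It is diagonalised by phases `h` with `h ∘ s = h⁻¹` and `h ∘ a = z h⁻¹`,
where `z ^ 2 ^ n = 1`; on the span of `h, h⁻¹` the eigenvalues `μ` of `a + 2s` satisfy `μ² = (2 +
z)(2 + z⁻¹) = 5 + 4 cos t` for `z = exp(it)`. Dyadic angles are dense and the spectrum is closed, so
both intervals are filled. -/

/-! ### The regular representation -/

section Markov

variable {G : Type*} [Group G]

/-- The left regular representation as bounded operators. -/
noncomputable abbrev regularOp (s : G) : lp (fun _ : G => ℂ) 2 →L[ℂ] lp (fun _ : G => ℂ) 2 :=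
  (leftRegular s).toContinuousLinearMap

theorem regularOp_mul (s t : G) : regularOp (s * t) = regularOp s * regularOp t := by
  ext f g
  change f ((s * t)⁻¹ * g) = f (t⁻¹ * (s⁻¹ * g))
  rw [mul_inv_rev, mul_assoc]

theorem regularOp_one : regularOp (1 : G) = 1 := by
  ext f g
  change f (1⁻¹ * g) = f g
  simp

theorem isSelfAdjoint_regularOp {s : G} (hs : s * s = 1) : IsSelfAdjoint (regularOp s) := by
  rw [ContinuousLinearMap.isSelfAdjoint_iff_isSymmetric]
  intro x y
  have h : leftRegular s (leftRegular s y) = y := by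
    have := congrArg (fun T => T y) (regularOp_mul s s)
    rw [hs, regularOp_one] at this
    exact this.symm
  change inner ℂ (leftRegular s x) y = inner ℂ x (leftRegular s y)
  conv_lhs => rw [← h]
  exact LinearIsometry.inner_map_map _ _ _

end Markov

/-! ### The upper bound in a C⋆-algebra -/

theorem norm_le_one_of_isSelfAdjoint_of_mul_self {A : Type*} [NormedRing A] [NormOneClass A]
    [StarRing A] [CStarRing A] {q : A} (hq : IsSelfAdjoint q) (h : q * q = 1) : ‖q‖ ≤ 1 := by
  have h1 := CStarRing.norm_star_mul_self (x := q)
  rw [hq.star_eq, h, norm_one] at h1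
  nlinarith [norm_nonneg q]

/-- In a C⋆-algebra, let `a` be a self-adjoint involution and let `1, b, c, d` be a Klein four-group
of self-adjoint elements. Then the mean of `a, b, c, d` has spectrum in `[-1/2, 0] ∪ [1/2, 1]`. -/
theorem spectrum_mean_subset {A : Type*} [CStarAlgebra A] [NormOneClass A] {a b c d : A}
    (ha : IsSelfAdjoint a) (hb : IsSelfAdjoint b) (hc : IsSelfAdjoint c) (hd : IsSelfAdjoint d)
    (haa : a * a = 1) (hbb : b * b = 1) (hcc : c * c = 1) (hdd : d * d = 1)
    (hbc : b * c = d) (hcb : c * b = d) (hbd : b * d = c) (hdb : d * b = c)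
    (hcd : c * d = b) (hdc : d * c = b) :
    spectrum ℂ ((4 : ℂ)⁻¹ • (a + b + c + d)) ⊆
      (fun x : ℝ => (x : ℂ)) '' (Set.Icc (-1 / 2) 0 ∪ Set.Icc (1 / 2) 1) := by
  intro z hz
  have hsum : IsSelfAdjoint (a + b + c + d) := ((ha.add hb).add hc).add hd
  have hM : IsSelfAdjoint ((4 : ℂ)⁻¹ • (a + b + c + d)) :=
    IsSelfAdjoint.smul (by simp [IsSelfAdjoint]) hsum
  obtain ⟨x, rfl⟩ : ∃ x : ℝ, (x : ℂ) = z := ⟨z.re, (hM.mem_spectrum_eq_re hz).symm⟩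
  refine ⟨x, ?_, rfl⟩
  -- `q = 2p - 1`, where `p = (1 + b + c + d) / 4` is the averaging projection of the Klein
  -- four-group.
  set q : A := (2 : ℂ)⁻¹ • (b + c + d - 1) with hq
  have hqs : IsSelfAdjoint q :=
    IsSelfAdjoint.smul (by simp [IsSelfAdjoint]) (((hb.add hc).add hd).sub (IsSelfAdjoint.one A))
  have hqq : q * q = 1 := by
    have : (b + c + d - 1) * (b + c + d - 1) = (4 : ℂ) • (1 : A) := by
      have h4 : (4 : ℂ) • (1 : A) = 1 + 1 + 1 + 1 := by
        rw [show (4 : ℂ) = 1 + 1 + 1 + 1 by norm_num]; simp only [add_smul, one_smul]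
      rw [h4]
      simp only [sub_mul, mul_sub, add_mul, mul_add, hbb, hcc, hdd, hbc, hcb, hbd, hdb, hcd, hdc,
        one_mul, mul_one]
      abel
    rw [hq, smul_mul_smul_comm, this, smul_smul]
    norm_num
  have hna := norm_le_one_of_isSelfAdjoint_of_mul_self ha haa
  have hnq := norm_le_one_of_isSelfAdjoint_of_mul_self hqs hqq
  -- Spectral mapping for `(4X - 1)² - 5`; the `5` is `a² + 4q²`.
  have hx2 : (((4 * x - 1) ^ 2 - 5 : ℝ) : ℂ) ∈ spectrum ℂ ((2 : ℂ) • (a * q + q * a)) := by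
    have h := spectrum.subset_polynomial_aeval ((4 : ℂ)⁻¹ • (a + b + c + d))
      ((4 * Polynomial.X - 1) ^ 2 - 5 : Polynomial ℂ) ⟨_, hz, rfl⟩
    convert h using 1
    · have h4 : (4 : A) = algebraMap ℂ A 4 := (map_ofNat _ 4).symm
      have h2 : (2 : A) = algebraMap ℂ A 2 := (map_ofNat _ 2).symm
      have e : (4 : A) * ((4 : ℂ)⁻¹ • (a + b + c + d)) - 1 = a + 2 * q := by
        rw [h4, h2, ← Algebra.smul_def, ← Algebra.smul_def, hq, smul_smul, smul_smul]
        norm_num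
        abel
      have h3 : (2 : ℂ) • (a * q + q * a) = 2 * (a * q + q * a) := by
        rw [h2, ← Algebra.smul_def]
      have e2 : (a + 2 * q) ^ 2 = a * a + 4 * (q * q) + 2 * (a * q + q * a) := by noncomm_ring
      have e3 : Polynomial.aeval ((4 : ℂ)⁻¹ • (a + b + c + d))
          ((4 * Polynomial.X - 1) ^ 2 - 5 : Polynomial ℂ) =
          (4 * ((4 : ℂ)⁻¹ • (a + b + c + d)) - 1) ^ 2 - 5 := by
        rw [map_sub, map_pow, map_sub, map_mul, Polynomial.aeval_X, map_one]
        congr 1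
        · rw [map_ofNat]
        · exact map_ofNat _ 5
      have h5 : (5 : A) = 1 + 4 * 1 := by norm_num
      rw [e3, e, h3, e2, haa, hqq, h5, add_sub_cancel_left]
    · simp
  have hn : ‖(2 : ℂ) • (a * q + q * a)‖ ≤ 4 := by
    rw [norm_smul]
    have h1 : ‖a * q‖ ≤ 1 := (norm_mul_le _ _).trans (mul_le_one₀ hna (norm_nonneg _) hnq)
    have h2 : ‖q * a‖ ≤ 1 := (norm_mul_le _ _).trans (mul_le_one₀ hnq (norm_nonneg _) hna)
    have h3 := norm_add_le (a * q) (q * a)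
    norm_num
    linarith
  have hle := (spectrum.norm_le_norm_of_mem hx2).trans hn
  rw [Complex.norm_real, Real.norm_eq_abs, abs_le] at hle
  obtain ⟨h1, h2⟩ := hle
  rcases le_total x (1 / 4) with h | h
  · left; constructor <;> nlinarith
  · right; constructor <;> nlinarith

/-! ### Eigenvalues of finite actions of amenable groups -/

section Folner

variable {G : Type*} [Group G]

/-- The restriction to `F` of the function `g ↦ v (g • x)`. -/
noncomputable def orbitFun {X : Type*} [MulAction G X] (F : Finset G) (v : X → ℂ) (x : X) :
    lp (fun _ : G => ℂ) 2 :=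
  ⟨fun g => (F : Set G).indicator (fun g => v (g • x)) g, memℓp_gen <| by
    refine summable_of_ne_finset_zero (s := F) fun g hg => ?_
    simp [hg]⟩

theorem orbitFun_apply {X : Type*} [MulAction G X] (F : Finset G) (v : X → ℂ) (x : X) (g : G) :
    orbitFun F v x g = (F : Set G).indicator (fun g => v (g • x)) g := rfl

theorem lp_norm_sq_eq_sum {ι : Type*} (f : lp (fun _ : ι => ℂ) 2) (B : Finset ι)
    (h : ∀ i ∉ B, f i = 0) : ‖f‖ ^ 2 = ∑ i ∈ B, ‖f i‖ ^ 2 := by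
  have h2 : 0 < (2 : ENNReal).toReal := by norm_num
  have := lp.norm_rpow_eq_tsum h2 f
  simp only [ENNReal.toReal_ofNat, Real.rpow_ofNat] at this
  rw [this, tsum_eq_sum]
  intro i hi
  simp [h i hi]

theorem norm_orbitFun_sq {X : Type*} [MulAction G X] (F : Finset G) (v : X → ℂ) (x : X) :
    ‖orbitFun F v x‖ ^ 2 = ∑ g ∈ F, ‖v (g • x)‖ ^ 2 := by
  rw [lp_norm_sq_eq_sum _ F fun g hg => by simp [orbitFun_apply, hg]]
  exact Finset.sum_congr rfl fun g hg => by simp [orbitFun_apply, hg]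

/-- Averaging over the base point: each `g` permutes `X`, so no transitivity is needed to find an
orbit on which `v` has at least average mass. -/
theorem exists_le_norm_orbitFun_sq {X : Type*} [MulAction G X] [Fintype X] [Nonempty X]
    (F : Finset G) (v : X → ℂ) :
    ∃ x, (F.card : ℝ) * ∑ y, ‖v y‖ ^ 2 ≤ Fintype.card X * ‖orbitFun F v x‖ ^ 2 := by
  have hs : ∑ x, ‖orbitFun F v x‖ ^ 2 = F.card * ∑ y, ‖v y‖ ^ 2 := by
    simp only [norm_orbitFun_sq]
    rw [Finset.sum_comm]
    have (g : G) : ∑ x, ‖v (g • x)‖ ^ 2 = ∑ y, ‖v y‖ ^ 2 :=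
      Equiv.sum_comp (MulAction.toPerm g : Equiv.Perm X) fun y => ‖v y‖ ^ 2
    simp [this]
  obtain ⟨x, -, hx⟩ := Finset.exists_max_image Finset.univ (fun x => ‖orbitFun F v x‖ ^ 2)
    Finset.univ_nonempty
  refine ⟨x, ?_⟩
  rw [← hs]
  simpa using Finset.sum_le_card_nsmul _ _ _ hx

open Classical in
/-- If `v` is an eigenfunction of the Markov operator of the action of an amenable group on a finite
set, then the eigenvalue lies in the spectrum of the group. -/
theorem mem_groupSpectrum_of_eigenfunction (hG : IsAmenableGroup G) {S : Finset G}
    (hS : S.Nonempty) {X : Type*} [MulAction G X] [Fintype X] (v : X → ℂ) (x₀ : X) (hv : v x₀ ≠ 0) (z : ℂ)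
    (heig : ∀ x, (S.card : ℂ)⁻¹ * ∑ s ∈ S, v (s⁻¹ • x) = z * v x) :
    z ∈ groupSpectrum S := by
  have : Nonempty X := ⟨x₀⟩
  by_contra hz
  have hu : IsUnit (markovOperator S - z • 1) := by
    have := spectrum.notMem_iff.mp hz
    rw [← IsUnit.neg_iff]
    simpa [Algebra.algebraMap_eq_smul_one] using this
  set T := markovOperator S - z • 1 with hT
  obtain ⟨R, hR⟩ := hu.exists_left_inv
  obtain ⟨K, hK⟩ : ∃ K, ∀ x, ‖v x‖ ≤ K := (Set.finite_range fun x => ‖v x‖).bddAbove.imp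
    fun K hK x => hK ⟨x, rfl⟩
  have hK0 : 0 ≤ K := (norm_nonneg _).trans (hK x₀)
  set W : ℝ := ∑ y, ‖v y‖ ^ 2 with hW
  have hW0 : 0 < W := Finset.sum_pos' (fun _ _ => by positivity)
    ⟨x₀, Finset.mem_univ _, by positivity⟩
  -- `L` bounds `T f` pointwise. `C` collects the constants in the final estimate, so that the
  -- Følner tolerance `W / (C + 1)` gives `|F| W ≤ C / (C + 1) * (|F| W)`, a contradiction.
  set L : ℝ := K + ‖z‖ * K with hL
  set C : ℝ := Fintype.card X * (‖R‖ ^ 2 * (2 * S.card * L ^ 2)) with hC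
  have hC0 : 0 ≤ C := by positivity
  obtain ⟨F, hF, hFε⟩ := hG S (W / (C + 1)) (by positivity)
  obtain ⟨x, hx⟩ := exists_le_norm_orbitFun_sq F v
  set f := orbitFun F v x with hf
  -- The boundary of `F`: those `g` for which some `s ∈ S` has exactly one of `g`, `s⁻¹ * g` in `F`.
  -- Off `B` the eigenvalue equation survives truncation, so `T f` vanishes there.
  set B : Finset G := S.biUnion fun s =>
    (F.image fun x => s * x) \ F ∪ F \ (F.image fun x => s * x) with hB
  have hBcard : (B.card : ℝ) ≤ S.card * (2 * (W / (C + 1) * F.card)) := by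
    have h1 : (B.card : ℝ) ≤ ∑ s ∈ S, (2 * (W / (C + 1) * F.card)) := by
      have : (B.card : ℝ) ≤ ((∑ s ∈ S, ((F.image fun x => s * x) \ F ∪
          F \ (F.image fun x => s * x)).card : ℕ) : ℝ) := by
        exact_mod_cast Finset.card_biUnion_le
      refine this.trans ?_
      push_cast
      refine Finset.sum_le_sum fun s hs => ?_
      have hc : (F.image fun x => s * x).card = F.card :=
        Finset.card_image_of_injective _ (mul_right_injective s)
      have h2 : (F \ (F.image fun x => s * x)).card = ((F.image fun x => s * x) \ F).card :=
        Finset.card_sdiff_comm hc.symm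
      have h3 := hFε s hs
      have h4 : ((((F.image fun x => s * x) \ F ∪ F \ (F.image fun x => s * x)).card : ℕ) : ℝ) ≤
          ((F.image fun x => s * x) \ F).card + (F \ (F.image fun x => s * x)).card := by
        exact_mod_cast Finset.card_union_le _ _
      rw [h2] at h4
      linarith
    simpa using h1
  have hmem (s g : G) : s⁻¹ * g ∈ F ↔ g ∈ F.image fun x => s * x := by
    simp
  have hTf (g : G) : T f g = (S.card : ℂ)⁻¹ * ∑ s ∈ S, f (s⁻¹ * g) - z * f g := by
    rw [hT, ← markovOperator_apply]
    rfl
  have hsupp : ∀ g ∉ B, T f g = 0 := by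
    intro g hg
    have hiff : ∀ s ∈ S, (s⁻¹ * g ∈ F ↔ g ∈ F) := by
      intro s hs
      rw [hmem]
      by_contra hcon
      exact hg (Finset.mem_biUnion.mpr ⟨s, hs, by
        simp only [Finset.mem_union, Finset.mem_sdiff]; tauto⟩)
    rw [hTf]
    by_cases hgF : g ∈ F
    · have : ∀ s ∈ S, f (s⁻¹ * g) = v (s⁻¹ • g • x) := fun s hs => by
        simp [hf, orbitFun_apply, (hiff s hs).mpr hgF, mul_smul]
      rw [Finset.sum_congr rfl this, heig]
      simp [hf, orbitFun_apply, hgF]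
    · have : ∀ s ∈ S, f (s⁻¹ * g) = 0 := fun s hs => by
        simp [hf, orbitFun_apply, mt (hiff s hs).mp hgF]
      rw [Finset.sum_congr rfl this]
      simp [hf, orbitFun_apply, hgF]
  have hfK (g : G) : ‖f g‖ ≤ K := by
    rw [hf, orbitFun_apply]
    exact (norm_indicator_le_norm_self _ _).trans (hK _)
  have hbd (g : G) : ‖T f g‖ ≤ L := by
    rw [hTf]
    refine (norm_sub_le _ _).trans (add_le_add ?_ ?_)
    · rw [norm_mul, norm_inv, Complex.norm_natCast]
      have h1 : ‖∑ s ∈ S, f (s⁻¹ * g)‖ ≤ S.card * K := by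
        simpa using norm_sum_le_of_le S fun s _ => hfK (s⁻¹ * g)
      have h2 : (0 : ℝ) < S.card := by exact_mod_cast hS.card_pos
      rw [inv_mul_le_iff₀ h2]
      exact h1
    · rw [norm_mul]
      exact mul_le_mul_of_nonneg_left (hfK g) (norm_nonneg _)
  have hTnorm : ‖T f‖ ^ 2 ≤ B.card * L ^ 2 := by
    rw [lp_norm_sq_eq_sum _ B hsupp]
    have := Finset.sum_le_card_nsmul B (fun g => ‖T f g‖ ^ 2) (L ^ 2)
      fun g _ => pow_le_pow_left₀ (norm_nonneg _) (hbd g) 2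
    simpa using this
  have hfT : ‖f‖ ≤ ‖R‖ * ‖T f‖ := by
    have : R (T f) = f := congrArg (fun A => A f) hR
    calc ‖f‖ = ‖R (T f)‖ := by rw [this]
      _ ≤ _ := R.le_opNorm _
  have hFpos : (0 : ℝ) < F.card := by exact_mod_cast hF.card_pos
  have h1 : ‖f‖ ^ 2 ≤ ‖R‖ ^ 2 * (S.card * (2 * (W / (C + 1) * F.card)) * L ^ 2) := by
    calc ‖f‖ ^ 2 ≤ (‖R‖ * ‖T f‖) ^ 2 := pow_le_pow_left₀ (norm_nonneg _) hfT 2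
      _ = ‖R‖ ^ 2 * ‖T f‖ ^ 2 := mul_pow _ _ _
      _ ≤ _ := mul_le_mul_of_nonneg_left
        (hTnorm.trans (mul_le_mul_of_nonneg_right hBcard (sq_nonneg _))) (sq_nonneg _)
  have h2 : (F.card : ℝ) * W ≤ C * (W / (C + 1) * F.card) := by
    refine hx.trans ((mul_le_mul_of_nonneg_left h1 (Nat.cast_nonneg _)).trans_eq ?_)
    rw [hC]; ring
  have h3 : C * (W / (C + 1) * F.card) = (C / (C + 1)) * (F.card * W) := by ring
  rw [h3] at h2
  have h4 : C / (C + 1) < 1 := by rw [div_lt_one (by positivity)]; linarith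
  nlinarith [mul_pos hFpos hW0]

end Folner

/-! ### Eigenfunctions on the levels of the tree -/

section Words

/-- The eigenfunction on words of the composition of the two swaps `flipFirst` and
`spinalMap (fun _ => true)`: it is inverted by the latter, and inverted and multiplied by `z` by
the former. -/
noncomputable def wordPhase : List Bool → ℂ → ℂ
  | [], _ => 1
  | true :: w, z => wordPhase w (z ^ 2)
  | false :: w, z => z * (wordPhase w (z ^ 2))⁻¹

theorem wordPhase_ne_zero (w : List Bool) {z : ℂ} (hz : z ≠ 0) : wordPhase w z ≠ 0 := by
  induction w generalizing z with
  | nil => simp [wordPhase]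
  | cons x w ih => cases x <;> simp [wordPhase, hz, ih (pow_ne_zero 2 hz)]

theorem wordPhase_replicate_true (n : ℕ) (z : ℂ) :
    wordPhase (List.replicate n true) z = 1 := by
  induction n generalizing z with
  | zero => rfl
  | succ n ih => simp [List.replicate_succ, wordPhase, ih]

/-- The phase is `z ^ k(w)` with `k([]) = 0`, `k(1w) = 2k(w)`, `k(0w) = 1 - 2k(w)`. This labels the
words of length `n` by residues mod `2 ^ n`; `flipFirst` is the reflection `k ↦ 1 - k` and the full
spinal swap is `k ↦ -k`. -/
theorem wordPhase_flipFirst (w : List Bool) {z : ℂ} (hz : z ^ 2 ^ w.length = 1) :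
    wordPhase (flipFirst w) z = z * (wordPhase w z)⁻¹ := by
  have hz0 : z ≠ 0 := by rintro rfl; simp at hz
  rcases w with _ | ⟨x, w⟩
  · simpa [flipFirst, wordPhase] using hz.symm
  · cases x
    · simp only [flipFirst, Bool.not_false, wordPhase]
      field_simp
    · simp [flipFirst, wordPhase]

theorem wordPhase_spinalMap (w : List Bool) {z : ℂ} (hz : z ^ 2 ^ w.length = 1) :
    wordPhase (spinalMap (fun _ => true) w) z = (wordPhase w z)⁻¹ := by
  have hz0 : z ≠ 0 := by rintro rfl; simp at hz
  induction w generalizing z with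
  | nil => simp [spinalMap, wordPhase]
  | cons x w ih =>
    have hz2 : (z ^ 2) ^ 2 ^ w.length = 1 := by
      rw [← pow_mul, ← pow_succ']; exact hz
    have hh := wordPhase_ne_zero w (pow_ne_zero 2 hz0)
    cases x
    · simp only [spinalMap, wordPhase, if_true, wordPhase_flipFirst w hz2]
      field_simp
    · simpa [spinalMap, wordPhase] using ih hz2 (pow_ne_zero 2 hz0)

/-- At every word, exactly two of the three spinal generators act as the full spinal swap and the
third one acts trivially. -/
theorem sum_spinal (ω : ℕ → Fin 3) (v : List Bool → ℂ) (w : List Bool) :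
    v (spinalMap (fun n => decide (ω n ≠ 2)) w) + v (spinalMap (fun n => decide (ω n ≠ 1)) w) +
      v (spinalMap (fun n => decide (ω n ≠ 0)) w) =
    2 * v (spinalMap (fun _ => true) w) + v w := by
  induction w generalizing ω v with
  | nil => simp only [spinalMap]; ring
  | cons x w ih =>
    cases x
    · have : ω 0 = 0 ∨ ω 0 = 1 ∨ ω 0 = 2 := by
        generalize ω 0 = i
        fin_cases i <;> simp
      rcases this with h | h | h <;> simp [spinalMap, h] <;> ring
    · exact ih (fun n => ω (n + 1)) fun u => v (true :: u)

theorem length_flipFirst (w : List Bool) : (flipFirst w).length = w.length := by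
  cases w <;> rfl

theorem length_spinalMap (I : ℕ → Bool) (w : List Bool) : (spinalMap I w).length = w.length := by
  induction w generalizing I with
  | nil => rfl
  | cons x w ih =>
    cases x
    · cases h : I 0 <;> simp [spinalMap, h, length_flipFirst]
    · simp [spinalMap, ih]

theorem spinalMap_singleton (I : ℕ → Bool) (x : Bool) : spinalMap I [x] = [x] := by
  cases x <;> simp [spinalMap, flipFirst]

/-- An eigenfunction of the sum of the four generators on the words of length `n`. -/
theorem sum_generators_eigen (ω : ℕ → Fin 3) {z μ : ℂ} (w : List Bool)
    (hz : z ^ 2 ^ w.length = 1) (hμ : μ ^ 2 = (2 + z) * (2 + z⁻¹)) (v : List Bool → ℂ)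
    (hv : ∀ u, v u = (2 + z⁻¹) * wordPhase u z + μ * (wordPhase u z)⁻¹) :
    v (genA w) + v (genB ω w) + v (genC ω w) + v (genD ω w) = (μ + 1) * v w := by
  have hz0 : z ≠ 0 := by rintro rfl; simp at hz
  have hh := wordPhase_ne_zero w hz0
  have h1 : v (flipFirst w) = (2 + z⁻¹) * z * (wordPhase w z)⁻¹ + μ * z⁻¹ * wordPhase w z := by
    rw [hv, wordPhase_flipFirst w hz, mul_inv, inv_inv]; ring
  have h2 : v (spinalMap (fun _ => true) w) =
      (2 + z⁻¹) * (wordPhase w z)⁻¹ + μ * wordPhase w z := by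
    rw [hv, wordPhase_spinalMap w hz, inv_inv]
  have h3 := sum_spinal ω v w
  change v (flipFirst w) + v (spinalMap _ w) + v (spinalMap _ w) + v (spinalMap _ w) = _
  rw [add_assoc, add_assoc, ← add_assoc (v (spinalMap _ w)), h3, h1, h2, hv w]
  -- With `h` the phase, `a + 2s` sends `h` to `(2 + z) h⁻¹` and `h⁻¹` to `(2 + z⁻¹) h`; only the
  -- coefficient of `h⁻¹` needs the equation for `μ²`.
  linear_combination -(wordPhase w z)⁻¹ * hμ

end Words

/-! ### Transfer from the levels to the group -/

section Spectrum

variable {G : Type*} [Group G]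

/-- The action on the words of a fixed length of a group mapping to length preserving
automorphisms. -/
@[reducible] def wordAction (ψ : G →* (binaryTree ≃g binaryTree)) (h : ∀ g w, (ψ g w).length = w.length)
    (n : ℕ) : MulAction G (List.Vector Bool n) where
  smul g w := ⟨ψ g w.1, (h g w.1).trans w.2⟩
  one_smul w := Subtype.ext (by
    change ψ 1 w.1 = w.1
    rw [map_one]; rfl)
  mul_smul g k w := Subtype.ext (by
    change ψ (g * k) w.1 = ψ g (ψ k w.1)
    rw [map_mul]; rfl)

theorem length_apply_of_closure {a b c d : G} (hgen : Subgroup.closure ({a, b, c, d} : Set G) = ⊤)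
    (ψ : G →* (binaryTree ≃g binaryTree)) {ω : ℕ → Fin 3} (ha : ψ a = genA) (hb : ψ b = genB ω)
    (hc : ψ c = genC ω) (hd : ψ d = genD ω) (g : G) (w : List Bool) :
    (ψ g w).length = w.length := by
  have hg : g ∈ Subgroup.closure ({a, b, c, d} : Set G) := hgen ▸ Subgroup.mem_top g
  induction hg using Subgroup.closure_induction generalizing w with
  | mem x hx =>
    rcases hx with rfl | rfl | rfl | rfl
    · rw [ha]; exact length_flipFirst w
    · rw [hb]; exact length_spinalMap _ w
    · rw [hc]; exact length_spinalMap _ w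
    · rw [hd]; exact length_spinalMap _ w
  | one => rw [map_one]; rfl
  | mul x y _ _ hx hy => rw [map_mul]; exact (hx _).trans (hy w)
  | inv x _ hx =>
    have h : ψ x (ψ x⁻¹ w) = w := by
      change (ψ x * ψ x⁻¹) w = w
      rw [← map_mul, mul_inv_cancel, map_one]; rfl
    rw [← hx (ψ x⁻¹ w), h]

theorem sum_four {α M : Type*} [DecidableEq α] [AddCommMonoid M] {a b c d : α} (hab : a ≠ b) (hac : a ≠ c)
    (had : a ≠ d) (hbc : b ≠ c) (hbd : b ≠ d) (hcd : c ≠ d) (f : α → M) :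
    ∑ s ∈ ({a, b, c, d} : Finset α), f s = f a + f b + f c + f d := by
  rw [Finset.sum_insert (by simp [*]), Finset.sum_insert (by simp [*]),
    Finset.sum_insert (by simp [*]), Finset.sum_singleton]
  simp only [add_assoc]

theorem card_four {α : Type*} [DecidableEq α] {a b c d : α} (hab : a ≠ b) (hac : a ≠ c)
    (had : a ≠ d) (hbc : b ≠ c) (hbd : b ≠ d) (hcd : c ≠ d) :
    ({a, b, c, d} : Finset α).card = 4 := by
  rw [Finset.card_eq_sum_ones, sum_four hab hac had hbc hbd hcd]

/-- `hne` says that the eigenfunction does not vanish at `1ⁿ`, where the phase is `1`. -/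
theorem mem_groupSpectrum_of_root_of_unity [DecidableEq G] (hG : IsAmenableGroup G) {a b c d : G}
    (hgen : Subgroup.closure ({a, b, c, d} : Set G) = ⊤)
    (ha : orderOf a = 2) (hb : orderOf b = 2) (hc : orderOf c = 2) (hd : orderOf d = 2)
    (hab : a ≠ b) (hac : a ≠ c) (had : a ≠ d) (hbc : b ≠ c) (hbd : b ≠ d) (hcd : c ≠ d)
    (ψ : G →* (binaryTree ≃g binaryTree)) {ω : ℕ → Fin 3} (hψa : ψ a = genA)
    (hψb : ψ b = genB ω) (hψc : ψ c = genC ω) (hψd : ψ d = genD ω) {z μ : ℂ} {n : ℕ}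
    (hz : z ^ 2 ^ n = 1) (hμ : μ ^ 2 = (2 + z) * (2 + z⁻¹)) (hne : 2 + z⁻¹ + μ ≠ 0) :
    (μ + 1) / 4 ∈ groupSpectrum ({a, b, c, d} : Finset G) := by
  let _ := wordAction ψ (length_apply_of_closure hgen ψ hψa hψb hψc hψd) n
  set v : List Bool → ℂ := fun u => (2 + z⁻¹) * wordPhase u z + μ * (wordPhase u z)⁻¹ with hv
  refine mem_groupSpectrum_of_eigenfunction hG ⟨a, by simp⟩
    (X := List.Vector Bool n) (fun w => v w.1)
    ⟨List.replicate n true, List.length_replicate⟩ ?_ _ fun w => ?_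
  · simpa [hv, wordPhase_replicate_true] using hne
  · rw [sum_four hab hac had hbc hbd hcd, card_four hab hac had hbc hbd hcd,
      inv_eq_self_of_orderOf_eq_two ha, inv_eq_self_of_orderOf_eq_two hb,
      inv_eq_self_of_orderOf_eq_two hc, inv_eq_self_of_orderOf_eq_two hd]
    change _ * (v (ψ a w.1) + v (ψ b w.1) + v (ψ c w.1) + v (ψ d w.1)) = _ * v w.1
    rw [hψa, hψb, hψc, hψd,
      sum_generators_eigen ω w.1 (by rw [w.2]; exact hz) hμ v fun _ => rfl]
    push_cast
    ring

end Spectrum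

/-! ### Density of dyadic angles -/

section Angles

open Filter Topology

/-- A sequence of odd multiples of `π / 2 ^ m` that converges to `θ`. -/
noncomputable def dyadicAngle (θ : ℝ) (m : ℕ) : ℝ :=
  (2 * ⌊θ / (2 * Real.pi) * 2 ^ m⌋₊ + 1) * Real.pi / 2 ^ m

theorem tendsto_dyadicAngle {θ : ℝ} (hθ : 0 ≤ θ) :
    Tendsto (dyadicAngle θ) atTop (𝓝 θ) := by
  have h2 : Tendsto (fun m : ℕ => (2 : ℝ) ^ m) atTop atTop :=
    tendsto_pow_atTop_atTop_of_one_lt (by norm_num)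
  have h1 := (tendsto_nat_floor_mul_div_atTop (a := θ / (2 * Real.pi)) (by positivity)).comp h2
  have h3 := (h1.const_mul (2 * Real.pi)).add (h2.inv_tendsto_atTop.const_mul Real.pi)
  have hpi := Real.pi_ne_zero
  have e : 2 * Real.pi * (θ / (2 * Real.pi)) + Real.pi * 0 = θ := by field_simp; ring
  rw [e] at h3
  refine h3.congr fun m => ?_
  simp only [Function.comp_apply, Pi.inv_apply, dyadicAngle]
  field_simp

/-- An odd numerator over `2 ^ m` is not an integer once `m ≥ 1`. This keeps `z` non-real, which
ensures a nonzero eigenfunction. -/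
theorem sin_dyadicAngle_ne_zero (θ : ℝ) {m : ℕ} (hm : 1 ≤ m) : Real.sin (dyadicAngle θ m) ≠ 0 := by
  intro h
  obtain ⟨k, hk⟩ := Real.sin_eq_zero_iff.mp h
  rw [dyadicAngle, mul_div_right_comm, mul_left_inj' Real.pi_ne_zero, eq_div_iff (by positivity)]
    at hk
  have hk' : k * 2 ^ m = 2 * (⌊θ / (2 * Real.pi) * 2 ^ m⌋₊ : ℤ) + 1 := by exact_mod_cast hk
  obtain ⟨m, rfl⟩ := Nat.exists_eq_add_of_le' hm
  rw [pow_succ, ← mul_assoc] at hk'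
  omega

theorem exp_dyadicAngle_pow (θ : ℝ) (m : ℕ) :
    Complex.exp (dyadicAngle θ m * Complex.I) ^ 2 ^ (m + 1) = 1 := by
  rw [← Complex.exp_nat_mul, Complex.exp_eq_one_iff]
  refine ⟨2 * ⌊θ / (2 * Real.pi) * 2 ^ m⌋₊ + 1, ?_⟩
  simp only [dyadicAngle]
  push_cast
  field_simp
  ring

theorem two_add_exp_mul_two_add_exp_inv (t : ℝ) :
    (2 + Complex.exp (t * Complex.I)) * (2 + (Complex.exp (t * Complex.I))⁻¹) =
      ((5 + 4 * Real.cos t : ℝ) : ℂ) := by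
  have h := Complex.two_cos (t : ℂ)
  rw [neg_mul, Complex.exp_neg] at h
  have h0 := Complex.exp_ne_zero (t * Complex.I)
  push_cast
  have h1 := mul_inv_cancel₀ h0
  linear_combination h1 - 2 * h

end Angles

/-! ### The spectrum of `G` -/

theorem theorem2 {G : Type*} [Group G] [DecidableEq G] (hG : IsAmenableGroup G)
    (a b c d : G) (hgen : Subgroup.closure ({a, b, c, d} : Set G) = ⊤)
    (ha : orderOf a = 2) (hb : orderOf b = 2) (hc : orderOf c = 2) (hd : orderOf d = 2)
    (hbcd : b * c * d = 1)
    (ω : ℕ → Fin 3) (hω : ω ∈ Omega2)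
    (φ : G →* grigorchukGroup ω) (hφ : Function.Surjective φ)
    (hφa : (φ a : binaryTree ≃g binaryTree) = genA)
    (hφb : (φ b : binaryTree ≃g binaryTree) = genB ω)
    (hφc : (φ c : binaryTree ≃g binaryTree) = genC ω)
    (hφd : (φ d : binaryTree ≃g binaryTree) = genD ω) :
    groupSpectrum ({a, b, c, d} : Finset G) =
      (fun x : ℝ => (x : ℂ)) '' (Set.Icc (-1 / 2) 0 ∪ Set.Icc (1 / 2) 1) := by
  have sq {x : G} (h : orderOf x = 2) : x * x = 1 := by rw [← pow_two, ← h, pow_orderOf_eq_one]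
  have ne_one {x : G} (h : orderOf x = 2) : x ≠ 1 := by rintro rfl; simp at h
  have haa := sq ha
  have hbb := sq hb
  have hcc := sq hc
  have hdd := sq hd
  have ib := inv_eq_self_of_orderOf_eq_two hb
  have ic := inv_eq_self_of_orderOf_eq_two hc
  have id := inv_eq_self_of_orderOf_eq_two hd
  have ebc : b * c = d := by rw [← id]; exact eq_inv_of_mul_eq_one_left hbcd
  have ecb : c * b = d := by rw [← id, ← ebc, mul_inv_rev, ib, ic]
  have ebd : b * d = c := by rw [← ebc, ← mul_assoc, hbb, one_mul]
  have edb : d * b = c := by rw [← ecb, mul_assoc, hbb, mul_one]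
  have ecd : c * d = b := by rw [← ecb, ← mul_assoc, hcc, one_mul]
  have edc : d * c = b := by rw [← ebc, mul_assoc, hcc, mul_one]
  have hbc : b ≠ c := by rintro rfl; exact ne_one hd (ebc.symm.trans hbb)
  have hbd : b ≠ d := by rintro rfl; exact ne_one hc (ebd.symm.trans hbb)
  have hcd : c ≠ d := by rintro rfl; exact ne_one hb (ecd.symm.trans hcc)
  set ψ : G →* (binaryTree ≃g binaryTree) := (grigorchukGroup ω).subtype.comp φ with hψ
  -- On words of length one `a` acts nontrivially and spinal elements trivially; distinctness makes
  -- `S` have four elements.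
  have hspinal (x : G) (I : ℕ → Bool) (hx : ψ x = spinalAut I) : a ≠ x := by
    rintro rfl
    have h : genA [true] = spinalAut I [true] := by rw [← hx]; exact congrArg (· [true]) hφa.symm
    change flipFirst [true] = spinalMap I [true] at h
    rw [spinalMap_singleton] at h
    simp [flipFirst] at h
  have hab := hspinal b _ hφb
  have hac := hspinal c _ hφc
  have had := hspinal d _ hφd
  refine Set.Subset.antisymm ?_ ?_
  · rw [groupSpectrum, markovOperator, sum_four hab hac had hbc hbd hcd,
      card_four hab hac had hbc hbd hcd]
    have key {x y w : G} (h : x * y = w) : regularOp x * regularOp y = regularOp w := by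
      rw [← h, regularOp_mul]
    have key1 {x : G} (h : x * x = 1) : regularOp x * regularOp x = 1 := by
      rw [← regularOp_mul, h, regularOp_one]
    have : Nontrivial (lp (fun _ : G => ℂ) 2) :=
      ⟨lp.single 2 1 1, 0, fun h => by
        have := congrArg (fun f => f 1) h
        simp at this⟩
    exact spectrum_mean_subset (isSelfAdjoint_regularOp haa) (isSelfAdjoint_regularOp hbb)
      (isSelfAdjoint_regularOp hcc) (isSelfAdjoint_regularOp hdd) (key1 haa) (key1 hbb)
      (key1 hcc) (key1 hdd) (key ebc) (key ecb) (key ebd) (key edb) (key ecd) (key edc)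
  · rintro _ ⟨x, hx, rfl⟩
    -- The sign `ε` picks the root `μ = ε √(5 + 4 cos t)`, hence which of the two intervals is
    -- reached; `y` is the cosine solving `5 + 4y = (4x - 1)²`.
    obtain ⟨ε, hε, hεx⟩ : ∃ ε : ℝ, ε ^ 2 = 1 ∧ 4 * x - 1 = ε * |4 * x - 1| := by
      rcases le_total 0 (4 * x - 1) with h | h
      · exact ⟨1, by norm_num, by rw [abs_of_nonneg h, one_mul]⟩
      · exact ⟨-1, by norm_num, by rw [abs_of_nonpos h]; ring⟩
    set y : ℝ := ((4 * x - 1) ^ 2 - 5) / 4 with hy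
    have hy1 : -1 ≤ y ∧ y ≤ 1 := by
      rcases hx with ⟨h1, h2⟩ | ⟨h1, h2⟩ <;> constructor <;> rw [hy] <;> nlinarith
    set θ := Real.arccos y with hθ
    set Λ : ℝ → ℂ := fun t => (((ε * √(5 + 4 * Real.cos t) : ℝ) : ℂ) + 1) / 4 with hΛ
    have hΛθ : Λ θ = x := by
      have h1 : 5 + 4 * Real.cos θ = (4 * x - 1) ^ 2 := by
        rw [hθ, Real.cos_arccos hy1.1 hy1.2, hy]; ring
      simp only [hΛ]
      rw [h1, Real.sqrt_sq_eq_abs, ← hεx]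
      push_cast
      ring
    have hcont : Continuous Λ := by
      simp only [hΛ]
      fun_prop
    have hlim : Filter.Tendsto (fun m => Λ (dyadicAngle θ m)) Filter.atTop (nhds (x : ℂ)) :=
      hΛθ ▸ (hcont.tendsto θ).comp (tendsto_dyadicAngle (Real.arccos_nonneg y))
    refine (spectrum.isClosed (𝕜 := ℂ) (markovOperator {a, b, c, d})).mem_of_tendsto hlim ?_
    filter_upwards [Filter.eventually_ge_atTop 1] with m hm
    refine mem_groupSpectrum_of_root_of_unity hG hgen ha hb hc hd hab hac had hbc hbd hcd ψ hφa hφb hφc hφd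
      (exp_dyadicAngle_pow θ m) ?_ ?_
    · rw [two_add_exp_mul_two_add_exp_inv, ← Complex.ofReal_pow, mul_pow, hε, one_mul,
        Real.sq_sqrt (by linarith [Real.neg_one_le_cos (dyadicAngle θ m)])]
    -- `μ` is real, so the imaginary part of `2 + z⁻¹ + μ` is `-sin t`.
    · intro h
      have him := congrArg Complex.im h
      rw [← Complex.exp_neg, ← neg_mul, ← Complex.ofReal_neg, Complex.add_im, Complex.add_im,
        Complex.exp_ofReal_mul_I_im, Complex.ofReal_im, Real.sin_neg] at him
      exact sin_dyadicAngle_ne_zero θ hm (by simpa using him)
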